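/- Let $n\in\mathbb N_0$. Functions take values in $\mathbb R\cup\{+\infty\}$, and $0\cdot(+\infty)=0$. For $F,\Phi,\Psi:\mathbb R^n\to\mathbb R\cup\{+\infty\}$ and $\tau\in\mathbb R$ put $\operatorname{dom}F=\{x: F(x)<+\infty\}$, $\operatorname{lev}_\tau F=\{x:F(x)\le\tau\}$, $\operatorname{argmin}F=\{x\in\mathbb R^n: F(x)\le F(y)\text{ for all }y\in\mathbb R^n\}$, and $OP(\Phi,\Psi)=\{\tau\in\mathbb R:\operatorname{dom}\Phi\cap\operatorname{lev}_\tau\Psi\neq\emptyset\}$. $F$ is proper if $F\not\equiv+\infty$. For real $\tau$ and real $\lambda\ge 0$ let $$\mathrm{SOL}(P_{1,\tau})=\{x\in\operatorname{lev}_\tau\Psi:\Phi(x)\le\Phi(y)\text{ for all }y\in\operatorname{lev}_\tau\Psi\},\qquad \mathrm{SOL}(P_{2,\lambda})=\operatorname{argmin}(\Phi+\lambda\Psi).$$ Interior and relative interior are denoted by $\operatorname{int}$ and $\operatorname{ri}$. **Theorem.** i) Let $\Phi,\Psi$ be proper and convex, let $\tau\in(\inf\Psi,+\infty)$ with $\operatorname{ri}(\operatorname{dom}\Phi)\cap\operatorname{ri}(\operatorname{lev}_\tau\Psi)\ne\emptyset$,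 and let $\hat x\in\mathrm{SOL}(P_{1,\tau})\cap\operatorname{int}(\operatorname{dom}\Psi)$. Then there is a real $\lambda\ge0$ with $\hat x\in\mathrm{SOL}(P_{2,\lambda})$. If $\hat x\notin\operatorname{argmin}\Phi$, every such $\lambda$ is positive. ii) Let $\Phi,\Psi$ be proper (not necessarily convex) with $\operatorname{dom}\Phi\cap\operatorname{dom}\Psi\ne\emptyset$, and let $\hat x\in\mathrm{SOL}(P_{2,\lambda})$ for a real $\lambda\ge0$. If $\lambda=0$, then for every $\tau\in OP(\Phi,\Psi)$: $\hat x\in\mathrm{SOL}(P_{1,\tau})$ if and only if $\tau\ge\Psi(\hat x)$. If $\lambda>0$, then $\tau:=\Psi(\hat x)$ is a real number belonging to $OP(\Phi,\Psi)$, and $\hat x\in\mathrm{SOL}(P_{1,\tau})$; if moreover $\Phi,\Psi$ are convex and $\hat x\in\operatorname{int}(\operatorname{dom}\Psi)$, then this $\tau$ is the only value in $OP(\Phi,\Psi)$ with $\hat x\in\mathrm{SOL}(P_{1,\tau})$ if and only if $\hat x\notin\operatorname{argmin}\Phi$. **Corollary.** Let $\Phi,\Psi$ be proper and convex, with $\operatorname{dom}\Psi$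 open and $\operatorname{dom}\Phi\subseteq\operatorname{dom}\Psi$, and let $\hat x\in\mathbb R^n$ belong neither to $\operatorname{argmin}\Phi$ nor to $\operatorname{argmin}\Psi$. (1) If $\hat x\in\mathrm{SOL}(P_{1,\tau})$ for some $\tau\in(\inf\Psi,+\infty)$ with $\operatorname{ri}(\operatorname{dom}\Phi)\cap\operatorname{ri}(\operatorname{lev}_\tau\Psi)\ne\emptyset$, then $\hat x\in\mathrm{SOL}(P_{2,\lambda})$ for some $\lambda>0$. (2) If $\hat x\in\mathrm{SOL}(P_{2,\lambda})$ for some $\lambda>0$, then there is exactly one $\tau\in OP(\Phi,\Psi)$ with $\hat x\in\mathrm{SOL}(P_{1,\tau})$, namely $\tau=\Psi(\hat x)$. -/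

import Mathlib

namespace PenalizedConstrained

/-- Euclidean space `ℝⁿ` (with `n = 0` allowed). -/
abbrev Rn (n : ℕ) : Type := EuclideanSpace ℝ (Fin n)

/-- A proper function `ℝⁿ → ℝ ∪ {+∞}`: the value `-∞` is never taken, and not all values are `+∞`. -/
def IsProper {n : ℕ} (F : Rn n → EReal) : Prop :=
  (∀ x, F x ≠ ⊥) ∧ ∃ x, F x ≠ ⊤

/-- Convexity of a function `ℝⁿ → ℝ ∪ {+∞}`, by Jensen's inequality. In `EReal` one has
`0 * ⊤ = 0`, so the cases `a = 0` and `b = 0` are harmless. It is only used for functions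
that never take the value `⊥`, so no sum `⊤ + ⊥` occurs. -/
def IsConvex {n : ℕ} (F : Rn n → EReal) : Prop :=
  ∀ x y : Rn n, ∀ a b : ℝ, 0 ≤ a → 0 ≤ b → a + b = 1 →
    F (a • x + b • y) ≤ (a : EReal) * F x + (b : EReal) * F y

/-- The effective domain of `F`. -/
def dom {n : ℕ} (F : Rn n → EReal) : Set (Rn n) := {x | F x < ⊤}

/-- The lower level set of `F` to the real level `τ`. -/
def lev {n : ℕ} (τ : ℝ) (F : Rn n → EReal) : Set (Rn n) := {x | F x ≤ (τ : EReal)}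

/-- The set of global minimizers of `F` over the whole of `ℝⁿ`. -/
def argmin {n : ℕ} (F : Rn n → EReal) : Set (Rn n) := {x | ∀ y, F x ≤ F y}

/-- The real levels `τ` for which `dom Φ` and `lev τ Ψ` overlap. -/
def OP {n : ℕ} (Φ Ψ : Rn n → EReal) : Set ℝ := {τ | (dom Φ ∩ lev τ Ψ).Nonempty}

/-- Solutions of the constrained problem: minimize `Φ x` subject to `Ψ x ≤ τ`. -/
def SOL₁ {n : ℕ} (Φ Ψ : Rn n → EReal) (τ : ℝ) : Set (Rn n) :=
  {x | x ∈ lev τ Ψ ∧ ∀ y ∈ lev τ Ψ, Φ x ≤ Φ y}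

/-- Solutions of the penalized problem: minimize `Φ x + l * Ψ x` over `ℝⁿ`,
with the convention `0 * ⊤ = 0` of `EReal`. -/
def SOL₂ {n : ℕ} (Φ Ψ : Rn n → EReal) (l : ℝ) : Set (Rn n) :=
  argmin fun x => Φ x + (l : EReal) * Ψ x

end PenalizedConstrained

namespace PenalizedConstrained

variable {n : ℕ} {F Φ Ψ : Rn n → EReal}

/-! If the constraint is slack at a solution interior to `dom Ψ`, every segment from that point
starts inside the level set, so by convexity the point minimizes `Φ` globally
(`mem_argmin_of_mem_SOL₁_of_lt`). This settles uniqueness of the level, and existence with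
multiplier zero. If the constraint is active, the relative interior condition yields a Slater point,
and separating the optimal pair from the open convex set `strictEpi` yields a multiplier
(`exists_multiplier`). The converse compares penalized values on the level set. -/

theorem IsProper.exists_coe_eq (hF : IsProper F) {x : Rn n} (hx : F x < ⊤) :
    ∃ r : ℝ, F x = r :=
  ⟨(F x).toReal, (EReal.coe_toReal hx.ne (hF.1 x)).symm⟩

theorem IsConvex.le_of_le (hF : IsConvex F) {x y : Rn n} {r s a b : ℝ}
    (hx : F x ≤ r) (hy : F y ≤ s) (ha : 0 ≤ a) (hb : 0 ≤ b) (hab : a + b = 1) :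
    F (a • x + b • y) ≤ ((a * r + b * s : ℝ) : EReal) := by
  refine (hF x y a b ha hb hab).trans ?_
  rw [EReal.coe_add, EReal.coe_mul, EReal.coe_mul]
  exact add_le_add (mul_le_mul_of_nonneg_left hx (by exact_mod_cast ha))
    (mul_le_mul_of_nonneg_left hy (by exact_mod_cast hb))

/-- A point of the relative interior of `s` lies strictly between any point of `s` and some other
point of `s`. -/
theorem exists_eq_combo_of_mem_intrinsicInterior {s : Set (Rn n)} {z w : Rn n}
    (hz : z ∈ intrinsicInterior ℝ s) (hw : w ∈ s) :
    ∃ u ∈ s, ∃ a b : ℝ, 0 < a ∧ 0 ≤ b ∧ a + b = 1 ∧ z = a • w + b • u := by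
  obtain ⟨y, hy, rfl⟩ := mem_intrinsicInterior.1 hz
  -- The line from `w` through `y`, prolonged slightly past `y`, stays in the affine span and hence
  -- in `s`.
  have hmem : ∀ t : ℝ, AffineMap.lineMap w (y : Rn n) (1 + t) ∈ affineSpan ℝ s := fun t =>
    AffineMap.lineMap_mem _ (subset_affineSpan ℝ s hw) y.2
  let g : ℝ → affineSpan ℝ s := fun t => ⟨AffineMap.lineMap w (y : Rn n) (1 + t), hmem t⟩
  have hg : Continuous g := by
    refine Continuous.subtype_mk ?_ _
    exact AffineMap.lineMap_continuous.comp (continuous_const.add continuous_id)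
  have hg0 : g 0 = y := by ext1; simp [g]
  have hev : ∀ᶠ t in nhds (0 : ℝ), g t ∈ ((↑) ⁻¹' s : Set (affineSpan ℝ s)) := by
    refine hg.continuousAt.eventually ?_
    rw [hg0]
    exact mem_interior_iff_mem_nhds.1 hy
  obtain ⟨t, ht, ht0⟩ :=
    ((hev.filter_mono nhdsWithin_le_nhds).and (self_mem_nhdsWithin (s := Set.Ioi (0 : ℝ)))).exists
  have ht0 : 0 < t := ht0
  refine ⟨_, ht, t / (1 + t), 1 / (1 + t), by positivity, by positivity, by field_simp; ring, ?_⟩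
  have h1 : (1 + t) ≠ 0 := by positivity
  simp only [g, AffineMap.lineMap_apply_module]
  rw [smul_add, smul_smul, smul_smul, ← add_assoc, ← add_smul]
  have h2 : t / (1 + t) + 1 / (1 + t) * (1 - (1 + t)) = 0 := by field_simp; ring
  have h3 : 1 / (1 + t) * (1 + t) = 1 := by field_simp
  rw [h2, h3, zero_smul, one_smul, zero_add]

/-- Such a point averages, with positive weight, a point strictly below the level with one in the
level set. This supplies the Slater point. -/
theorem IsConvex.lt_of_mem_intrinsicInterior_lev (hF : IsProper F) (hc : IsConvex F) {τ : ℝ}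
    (hτ : (⨅ x, F x) < (τ : EReal)) {z : Rn n} (hz : z ∈ intrinsicInterior ℝ (lev τ F)) :
    F z < τ := by
  obtain ⟨w, hw⟩ := iInf_lt_iff.1 hτ
  obtain ⟨u, hu, a, b, ha, hb, hab, rfl⟩ :=
    exists_eq_combo_of_mem_intrinsicInterior hz (show w ∈ lev τ F from hw.le)
  obtain ⟨r, hr⟩ := hF.exists_coe_eq (hw.trans (EReal.coe_lt_top τ))
  rw [hr, EReal.coe_lt_coe_iff] at hw
  refine (hc.le_of_le hr.le hu ha.le hb hab).trans_lt ?_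
  rw [EReal.coe_lt_coe_iff]
  have : b = 1 - a := by linarith
  subst this
  nlinarith

/-! ### Convex functions along segments. -/

theorem exists_combo_mem_of_mem_interior {s : Set (Rn n)} {x : Rn n} (hx : x ∈ interior s)
    (y : Rn n) : ∃ t : ℝ, 0 < t ∧ t ≤ 1 ∧ (1 - t) • x + t • y ∈ s := by
  have hg : Continuous fun t : ℝ => (1 - t) • x + t • y := by fun_prop
  have hev : ∀ᶠ t in nhds (0 : ℝ), (1 - t) • x + t • y ∈ s := by
    refine hg.continuousAt.eventually ?_
    simpa using mem_interior_iff_mem_nhds.1 hx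
  obtain ⟨t, ⟨ht, ht1⟩, ht0⟩ :=
    (((hev.and (Iic_mem_nhds zero_lt_one)).filter_mono nhdsWithin_le_nhds).and
      (self_mem_nhdsWithin (s := Set.Ioi (0 : ℝ)))).exists
  exact ⟨t, ht0, ht1, ht⟩

/-- Any segment issuing from an interior point of `dom F` stays, initially, below each level
exceeding the value at that point. -/
theorem IsConvex.exists_combo_mem_lev (hF : IsProper F) (hc : IsConvex F) {x : Rn n} {τ : ℝ}
    (hx : x ∈ interior (dom F)) (hτ : F x < τ) (y : Rn n) :
    ∃ t : ℝ, 0 < t ∧ t ≤ 1 ∧ (1 - t) • x + t • y ∈ lev τ F := by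
  obtain ⟨t, ht0, ht1, ht⟩ := exists_combo_mem_of_mem_interior hx y
  obtain ⟨r, hr⟩ := hF.exists_coe_eq (hτ.trans (EReal.coe_lt_top τ))
  obtain ⟨s, hs⟩ := hF.exists_coe_eq ht
  rw [hr, EReal.coe_lt_coe_iff] at hτ
  have hd : 0 < |s - r| + (τ - r) := add_pos_of_nonneg_of_pos (abs_nonneg _) (sub_pos.2 hτ)
  -- Chosen so that `c ≤ 1` and `c * |s - r| ≤ τ - r`: shrinking the step by `c` keeps Jensen's
  -- bound below `τ`.
  set c := (τ - r) / (|s - r| + (τ - r)) with hcdef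
  have hτr : 0 < τ - r := sub_pos.2 hτ
  have hc0 : 0 < c := div_pos hτr hd
  have hc1 : c ≤ 1 := (div_le_one hd).2 (by linarith [abs_nonneg (s - r)])
  have hcs : c * |s - r| ≤ τ - r := by
    have : c * (|s - r| + (τ - r)) = τ - r := div_mul_cancel₀ _ hd.ne'
    nlinarith [mul_pos hc0 hτr]
  refine ⟨c * t, mul_pos hc0 ht0, mul_le_one₀ hc1 ht0.le ht1, ?_⟩
  have key := hc.le_of_le hr.le hs.le (sub_nonneg.2 hc1) hc0.le (sub_add_cancel 1 c)
  have e : (1 - c) • x + c • ((1 - t) • x + t • y) = (1 - c * t) • x + (c * t) • y := by module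
  rw [e] at key
  refine key.trans (EReal.coe_le_coe_iff.2 ?_)
  nlinarith [mul_le_mul_of_nonneg_left (le_abs_self (s - r)) hc0.le]

/-- A point minimizing a convex function along the initial part of each segment issuing from it
is a global minimizer. -/
theorem IsConvex.mem_argmin (hF : IsProper F) (hc : IsConvex F) {x : Rn n} (hx : F x < ⊤)
    (h : ∀ y, ∃ t : ℝ, 0 < t ∧ t ≤ 1 ∧ F x ≤ F ((1 - t) • x + t • y)) : x ∈ argmin F := by
  intro y
  by_contra! hy
  obtain ⟨t, ht0, ht1, ht⟩ := h y
  obtain ⟨r, hr⟩ := hF.exists_coe_eq hx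
  obtain ⟨s, hs⟩ := hF.exists_coe_eq (hy.trans hx)
  have key := ht.trans (hc.le_of_le hr.le hs.le (sub_nonneg.2 ht1) ht0.le (sub_add_cancel 1 t))
  rw [hr, EReal.coe_le_coe_iff] at key
  rw [hr, hs, EReal.coe_lt_coe_iff] at hy
  nlinarith

theorem mem_argmin_of_mem_SOL₁_of_lt (hΦ : IsProper Φ) (hΦc : IsConvex Φ) (hΨ : IsProper Ψ)
    (hΨc : IsConvex Ψ) {x : Rn n} {τ : ℝ} (hx : x ∈ SOL₁ Φ Ψ τ) (hd : Φ x < ⊤)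
    (hint : x ∈ interior (dom Ψ)) (hlt : Ψ x < τ) : x ∈ argmin Φ := by
  refine hΦc.mem_argmin hΦ hd fun y => ?_
  obtain ⟨t, ht0, ht1, ht⟩ := hΨc.exists_combo_mem_lev hΨ hint hlt y
  exact ⟨t, ht0, ht1, hx.2 _ ht⟩

theorem mem_SOL₂_zero_iff {x : Rn n} : x ∈ SOL₂ Φ Ψ 0 ↔ x ∈ argmin Φ := by
  simp [SOL₂, argmin]

theorem pos_of_mem_SOL₂ {x : Rn n} (hx : x ∉ argmin Φ) {l : ℝ} (hl : 0 ≤ l)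
    (h : x ∈ SOL₂ Φ Ψ l) : 0 < l := by
  refine lt_of_le_of_ne hl ?_
  rintro rfl
  exact hx (mem_SOL₂_zero_iff.1 h)

/-! ### Separation and the multiplier. -/

/-- The values `(r, s)` strictly dominating a value of `(Φ, Ψ)`. -/
def strictEpi (Φ Ψ : Rn n → EReal) : Set (ℝ × ℝ) :=
  {p | ∃ x, ∃ r s : ℝ, Φ x ≤ r ∧ Ψ x ≤ s ∧ r < p.1 ∧ s < p.2}

theorem isOpen_strictEpi : IsOpen (strictEpi Φ Ψ) := by
  simp only [strictEpi, Set.ofPred_exists]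
  refine isOpen_iUnion fun x => isOpen_iUnion fun r => isOpen_iUnion fun s => ?_
  simp only [Set.ofPred_and]
  exact isOpen_const.inter (isOpen_const.inter
    ((isOpen_lt continuous_const continuous_fst).inter (isOpen_lt continuous_const continuous_snd)))

theorem convex_strictEpi (hΦ : IsConvex Φ) (hΨ : IsConvex Ψ) : Convex ℝ (strictEpi Φ Ψ) := by
  rintro p ⟨x, r, s, h1, h2, h3, h4⟩ q ⟨y, r', s', h1', h2', h3', h4'⟩ a b ha hb hab
  refine ⟨a • x + b • y, _, _, hΦ.le_of_le h1 h1' ha hb hab, hΨ.le_of_le h2 h2' ha hb hab, ?_, ?_⟩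
  · have := (convex_Ioi (0 : ℝ)) (sub_pos.2 h3) (sub_pos.2 h3') ha hb hab
    simp only [smul_eq_mul, Set.mem_Ioi, Prod.fst_add, Prod.smul_fst] at this ⊢
    linarith
  · have := (convex_Ioi (0 : ℝ)) (sub_pos.2 h4) (sub_pos.2 h4') ha hb hab
    simp only [smul_eq_mul, Set.mem_Ioi, Prod.snd_add, Prod.smul_snd] at this ⊢
    linarith

/-- Lagrange multiplier under Slater's condition. -/
theorem exists_multiplier (hΦ : IsConvex Φ) (hΨ : IsConvex Ψ) {φ τ : ℝ}
    (hmin : ∀ x, ∀ r s : ℝ, Φ x ≤ r → Ψ x ≤ s → s < τ → φ ≤ r)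
    {z : Rn n} {rz sz : ℝ} (hz : Φ z ≤ rz) (hz' : Ψ z ≤ sz) (hlt : sz < τ) :
    ∃ l : ℝ, 0 ≤ l ∧ ∀ x, ∀ r s : ℝ, Φ x ≤ r → Ψ x ≤ s → φ + l * τ ≤ r + l * s := by
  have hnot : ((φ, τ) : ℝ × ℝ) ∉ strictEpi Φ Ψ := by
    rintro ⟨x, r, s, h1, h2, h3, h4⟩
    exact absurd (hmin x r s h1 h2 h4) (not_le.2 h3)
  obtain ⟨f, hf⟩ := geometric_hahn_banach_open_point (convex_strictEpi hΦ hΨ)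
    isOpen_strictEpi hnot
  have hlin : ∀ u v : ℝ, f (u, v) = u * f (1, 0) + v * f (0, 1) := by
    intro u v
    have : ((u, v) : ℝ × ℝ) = u • (1, 0) + v • (0, 1) := by simp
    rw [this, map_add, map_smul, map_smul, smul_eq_mul, smul_eq_mul]
  generalize f (1, 0) = α at hlin
  generalize f (0, 1) = β at hlin
  have hf' : ∀ x, ∀ r s : ℝ, Φ x ≤ r → Ψ x ≤ s → ∀ u v : ℝ, r < u → s < v →
      u * α + v * β < φ * α + τ * β := by
    intro x r s h1 h2 u v h3 h4
    have := hf (u, v) ⟨x, r, s, h1, h2, h3, h4⟩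
    rwa [hlin, hlin φ τ] at this
  have hα : α ≤ 0 := by
    by_contra! h
    have h1 := hf' z rz sz hz hz' (max (rz + 1) φ) τ
      ((lt_add_one rz).trans_le (le_max_left _ _)) hlt
    nlinarith [le_max_right (rz + 1) φ]
  have hβ : β ≤ 0 := by
    by_contra! h
    set c := φ * α + τ * β - (rz + 1) * α
    have h1 := hf' z rz sz hz hz' (rz + 1) (max (sz + 1) (c / β)) (lt_add_one rz)
      ((lt_add_one sz).trans_le (le_max_left _ _))
    have h2 : c ≤ max (sz + 1) (c / β) * β := (div_le_iff₀ h).1 (le_max_right _ _)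
    simp only [c] at h2
    linarith
  -- Slater's condition excludes a vertical hyperplane: with `α = 0`, a level `v` between `sz` and
  -- `τ` contradicts `β ≤ 0`.
  have hα0 : α < 0 := by
    refine lt_of_le_of_ne hα ?_
    rintro rfl
    obtain ⟨v, hv, hv'⟩ := exists_between hlt
    have h1 := hf' z rz sz hz hz' (rz + 1) v (lt_add_one rz) hv
    nlinarith
  refine ⟨β / α, div_nonneg_of_nonpos hβ hα, fun x r s h1 h2 => ?_⟩
  -- Let the strict slack in both coordinates tend to zero.
  have hle : r * α + s * β ≤ φ * α + τ * β := by
    have hcont : Continuous fun ε : ℝ => (r + ε) * α + (s + ε) * β := by fun_prop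
    have ht : Filter.Tendsto (fun ε : ℝ => (r + ε) * α + (s + ε) * β)
        (nhdsWithin 0 (Set.Ioi 0)) (nhds (r * α + s * β)) := by
      simpa using (hcont.tendsto 0).mono_left nhdsWithin_le_nhds
    refine le_of_tendsto ht ?_
    filter_upwards [self_mem_nhdsWithin] with ε hε
    exact (hf' x r s h1 h2 _ _ (lt_add_of_pos_right r hε) (lt_add_of_pos_right s hε)).le
  have e : ∀ u v : ℝ, u + β / α * v = (u * α + v * β) / α := by
    intro u v
    rw [add_div, mul_div_cancel_right₀ _ hα0.ne, mul_comm v β, mul_div_right_comm]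
  rw [e, e]
  exact div_le_div_of_nonpos_of_le hα hle

theorem exists_mem_SOL₂_of_mem_SOL₁ (hΦ : IsProper Φ) (hΦc : IsConvex Φ) (hΨ : IsProper Ψ)
    (hΨc : IsConvex Ψ) {τ : ℝ} (hτ : (⨅ x, Ψ x) < (τ : EReal))
    (hri : (intrinsicInterior ℝ (dom Φ) ∩ intrinsicInterior ℝ (lev τ Ψ)).Nonempty)
    {x : Rn n} (hx : x ∈ SOL₁ Φ Ψ τ) (hint : x ∈ interior (dom Ψ)) :
    ∃ l : ℝ, 0 ≤ l ∧ x ∈ SOL₂ Φ Ψ l := by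
  obtain ⟨z, hzΦ, hzΨ⟩ := hri
  have hz : Φ z < ⊤ := intrinsicInterior_subset (s := dom Φ) hzΦ
  have hz' : Ψ z < τ := hΨc.lt_of_mem_intrinsicInterior_lev hΨ hτ hzΨ
  have hd : Φ x < ⊤ := (hx.2 z hz'.le).trans_lt hz
  by_cases hmin : x ∈ argmin Φ
  · exact ⟨0, le_rfl, mem_SOL₂_zero_iff.2 hmin⟩
  have hΨx : Ψ x = τ := by
    by_contra hne
    exact hmin (mem_argmin_of_mem_SOL₁_of_lt hΦ hΦc hΨ hΨc hx hd hint (lt_of_le_of_ne hx.1 hne))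
  obtain ⟨rz, hrz⟩ := hΦ.exists_coe_eq hz
  obtain ⟨sz, hsz⟩ := hΨ.exists_coe_eq (hz'.trans (EReal.coe_lt_top τ))
  obtain ⟨φ, hφ⟩ := hΦ.exists_coe_eq hd
  obtain ⟨l, hl, hle⟩ := exists_multiplier hΦc hΨc (φ := φ) (τ := τ)
    (fun y r s h1 h2 h3 => by
      have := (hx.2 y (h2.trans (EReal.coe_le_coe_iff.2 h3.le))).trans h1
      rwa [hφ, EReal.coe_le_coe_iff] at this)
    hrz.le hsz.le (by rwa [hsz, EReal.coe_lt_coe_iff] at hz')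
  -- The multiplier inequality says nothing outside `dom Ψ`, where positivity of `l` makes the
  -- penalty infinite. If `l = 0`, it gives minimality of `Φ` near `x`, hence globally by convexity.
  have hl0 : 0 < l := by
    refine lt_of_le_of_ne hl ?_
    rintro rfl
    refine hmin (hΦc.mem_argmin hΦ hd fun y => ?_)
    obtain ⟨t, ht0, ht1, ht⟩ := exists_combo_mem_of_mem_interior hint y
    refine ⟨t, ht0, ht1, ?_⟩
    obtain ⟨s, hs⟩ := hΨ.exists_coe_eq ht
    rcases lt_or_eq_of_le (le_top (a := Φ ((1 - t) • x + t • y))) with h | h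
    · obtain ⟨r, hr⟩ := hΦ.exists_coe_eq h
      have := hle _ r s hr.le hs.le
      rw [hr, hφ, EReal.coe_le_coe_iff]
      linarith
    · rw [h]
      exact le_top
  refine ⟨l, hl, fun y => ?_⟩
  show Φ x + (l : EReal) * Ψ x ≤ Φ y + (l : EReal) * Ψ y
  rcases lt_or_eq_of_le (le_top (a := Ψ y)) with h | h
  · obtain ⟨s, hs⟩ := hΨ.exists_coe_eq h
    rcases lt_or_eq_of_le (le_top (a := Φ y)) with h' | h'
    · obtain ⟨r, hr⟩ := hΦ.exists_coe_eq h'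
      rw [hφ, hΨx, hr, hs]
      exact_mod_cast hle y r s hr.le hs.le
    · rw [h', hs, ← EReal.coe_mul, EReal.top_add_coe]
      exact le_top
  · rw [h, EReal.coe_mul_top_of_pos hl0, EReal.add_top_of_ne_bot (hΦ.1 y)]
    exact le_top

/-! ### From penalized to constrained solutions. -/

theorem lt_top_of_mem_SOL₂ (hΦ : IsProper Φ) (hΨ : IsProper Ψ) (hne : (dom Φ ∩ dom Ψ).Nonempty)
    {x : Rn n} {l : ℝ} (hl : 0 < l) (hx : x ∈ SOL₂ Φ Ψ l) : Φ x < ⊤ ∧ Ψ x < ⊤ := by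
  obtain ⟨y, hy, hy'⟩ := hne
  obtain ⟨r, hr⟩ := hΦ.exists_coe_eq hy
  obtain ⟨s, hs⟩ := hΨ.exists_coe_eq hy'
  have h : Φ x + (l : EReal) * Ψ x < ⊤ := by
    refine (hx y).trans_lt ?_
    simp only [hr, hs]
    exact_mod_cast EReal.coe_lt_top (r + l * s)
  have hΨx : Ψ x < ⊤ := by
    by_contra hΨx
    rw [not_lt_top_iff.1 hΨx, EReal.coe_mul_top_of_pos hl,
      EReal.add_top_of_ne_bot (hΦ.1 x)] at h
    exact lt_irrefl _ h
  refine ⟨?_, hΨx⟩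
  by_contra hΦx
  obtain ⟨v, hv⟩ := hΨ.exists_coe_eq hΨx
  rw [not_lt_top_iff.1 hΦx, hv, ← EReal.coe_mul, EReal.top_add_coe] at h
  exact lt_irrefl _ h

/-- On the level set the penalty is at most `l * τ`, its value at `x`; cancelling this finite term
compares `Φ` alone. -/
theorem mem_SOL₁_of_mem_SOL₂ (hΦ : IsProper Φ) {x : Rn n} {l τ : ℝ}
    (hl : 0 < l) (hx : x ∈ SOL₂ Φ Ψ l) (hd : Φ x < ⊤) (hτ : Ψ x = τ) : x ∈ SOL₁ Φ Ψ τ := by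
  refine ⟨hτ.le, fun y hy => ?_⟩
  rcases lt_or_eq_of_le (le_top (a := Φ y)) with h | h
  · obtain ⟨φ, hφ⟩ := hΦ.exists_coe_eq hd
    obtain ⟨r, hr⟩ := hΦ.exists_coe_eq h
    have h1 : Φ x + (l : EReal) * Ψ x ≤ Φ y + (l : EReal) * (τ : EReal) :=
      (hx y).trans (add_le_add le_rfl
        (mul_le_mul_of_nonneg_left hy (by exact_mod_cast hl.le)))
    rw [hφ, hτ, hr] at h1
    have h2 : φ + l * τ ≤ r + l * τ := by exact_mod_cast h1
    rw [hφ, hr, EReal.coe_le_coe_iff]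
    linarith
  · rw [h]
    exact le_top

theorem eq_of_mem_SOL₁ (hΦ : IsProper Φ) (hΦc : IsConvex Φ) (hΨ : IsProper Ψ)
    (hΨc : IsConvex Ψ) {x : Rn n} {τ τ' : ℝ} (hd : Φ x < ⊤) (hint : x ∈ interior (dom Ψ))
    (hτ : Ψ x = τ) (hmin : x ∉ argmin Φ) (hx : x ∈ SOL₁ Φ Ψ τ') : τ' = τ := by
  have hle : τ ≤ τ' := by
    have : Ψ x ≤ τ' := hx.1
    rwa [hτ, EReal.coe_le_coe_iff] at this
  by_contra hne
  refine hmin (mem_argmin_of_mem_SOL₁_of_lt hΦ hΦc hΨ hΨc hx hd hint ?_)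
  rw [hτ, EReal.coe_lt_coe_iff]
  exact lt_of_le_of_ne hle (Ne.symm hne)

end PenalizedConstrained

open PenalizedConstrained in
theorem mainTheorem7 (n : ℕ) :
    -- Part i)
    (∀ Φ Ψ : Rn n → EReal,
      IsProper Φ → IsConvex Φ → IsProper Ψ → IsConvex Ψ →
      ∀ τ : ℝ, (⨅ x, Ψ x) < (τ : EReal) →
      (intrinsicInterior ℝ (dom Φ) ∩ intrinsicInterior ℝ (lev τ Ψ)).Nonempty →
      ∀ xhat ∈ SOL₁ Φ Ψ τ, xhat ∈ interior (dom Ψ) →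
        (∃ l : ℝ, 0 ≤ l ∧ xhat ∈ SOL₂ Φ Ψ l) ∧
        (xhat ∉ argmin Φ → ∀ l : ℝ, 0 ≤ l → xhat ∈ SOL₂ Φ Ψ l → 0 < l)) ∧
    -- Part ii)
    (∀ Φ Ψ : Rn n → EReal,
      IsProper Φ → IsProper Ψ → (dom Φ ∩ dom Ψ).Nonempty →
      ∀ xhat : Rn n,
        (xhat ∈ SOL₂ Φ Ψ 0 →
          ∀ τ ∈ OP Φ Ψ, (xhat ∈ SOL₁ Φ Ψ τ ↔ Ψ xhat ≤ (τ : EReal))) ∧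
        (∀ l : ℝ, 0 < l → xhat ∈ SOL₂ Φ Ψ l →
          ∃ τ ∈ OP Φ Ψ, (τ : EReal) = Ψ xhat ∧ xhat ∈ SOL₁ Φ Ψ τ ∧
            (IsConvex Φ → IsConvex Ψ → xhat ∈ interior (dom Ψ) →
              ((∀ τ' ∈ OP Φ Ψ, xhat ∈ SOL₁ Φ Ψ τ' → τ' = τ) ↔ xhat ∉ argmin Φ)))) ∧
    -- Corollary
    (∀ Φ Ψ : Rn n → EReal,
      IsProper Φ → IsConvex Φ → IsProper Ψ → IsConvex Ψ →
      IsOpen (dom Ψ) → dom Φ ⊆ dom Ψ →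
      ∀ xhat : Rn n, xhat ∉ argmin Φ → xhat ∉ argmin Ψ →
        (∀ τ : ℝ, (⨅ x, Ψ x) < (τ : EReal) →
          (intrinsicInterior ℝ (dom Φ) ∩ intrinsicInterior ℝ (lev τ Ψ)).Nonempty →
          xhat ∈ SOL₁ Φ Ψ τ → ∃ l : ℝ, 0 < l ∧ xhat ∈ SOL₂ Φ Ψ l) ∧
        (∀ l : ℝ, 0 < l → xhat ∈ SOL₂ Φ Ψ l →
          ∃ τ : ℝ, (τ : EReal) = Ψ xhat ∧ τ ∈ OP Φ Ψ ∧ xhat ∈ SOL₁ Φ Ψ τ ∧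
            ∀ τ' ∈ OP Φ Ψ, xhat ∈ SOL₁ Φ Ψ τ' → τ' = τ)) := by
  refine ⟨?_, ?_, ?_⟩
  · intro Φ Ψ hΦ hΦc hΨ hΨc τ hτ hri x hx hint
    exact ⟨exists_mem_SOL₂_of_mem_SOL₁ hΦ hΦc hΨ hΨc hτ hri hx hint,
      fun hmin l hl h => pos_of_mem_SOL₂ hmin hl h⟩
  · intro Φ Ψ hΦ hΨ hne x
    refine ⟨fun hx τ _ => ⟨fun h => h.1, fun h => ⟨h, fun y _ => mem_SOL₂_zero_iff.1 hx y⟩⟩, ?_⟩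
    intro l hl hx
    obtain ⟨hd, hd'⟩ := lt_top_of_mem_SOL₂ hΦ hΨ hne hl hx
    obtain ⟨τ, hτ⟩ := hΨ.exists_coe_eq hd'
    refine ⟨τ, ⟨x, hd, hτ.le⟩, hτ.symm, mem_SOL₁_of_mem_SOL₂ hΦ hl hx hd hτ, ?_⟩
    intro hΦc hΨc hint
    refine ⟨fun huniq hmin => ?_,
      fun hmin τ' _ h => eq_of_mem_SOL₁ hΦ hΦc hΨ hΨc hd hint hτ hmin h⟩
    -- A global minimizer of `Φ` solves the constrained problem at every larger level too, so
    -- uniqueness fails.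
    have hlev : x ∈ lev (τ + 1) Ψ := hτ.le.trans (EReal.coe_le_coe_iff.2 (by linarith))
    have := huniq (τ + 1) ⟨x, hd, hlev⟩ ⟨hlev, fun y _ => hmin y⟩
    linarith
  · intro Φ Ψ hΦ hΦc hΨ hΨc hopen hsub x hminΦ _
    refine ⟨fun τ hτ hri hx => ?_, fun l hl hx => ?_⟩
    · have hint : x ∈ interior (dom Ψ) := by
        rw [hopen.interior_eq]
        exact lt_of_le_of_lt hx.1 (EReal.coe_lt_top τ)
      obtain ⟨l, hl, h⟩ := exists_mem_SOL₂_of_mem_SOL₁ hΦ hΦc hΨ hΨc hτ hri hx hint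
      exact ⟨l, pos_of_mem_SOL₂ hminΦ hl h, h⟩
    · obtain ⟨y, hy⟩ := hΦ.2
      have hy : y ∈ dom Φ := lt_top_iff_ne_top.2 hy
      obtain ⟨hd, hd'⟩ := lt_top_of_mem_SOL₂ hΦ hΨ ⟨y, hy, hsub hy⟩ hl hx
      obtain ⟨τ, hτ⟩ := hΨ.exists_coe_eq hd'
      have hint : x ∈ interior (dom Ψ) := by
        rw [hopen.interior_eq]
        exact hd'
      exact ⟨τ, hτ.symm, ⟨x, hd, hτ.le⟩, mem_SOL₁_of_mem_SOL₂ hΦ hl hx hd hτ,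
        fun τ' _ h => eq_of_mem_SOL₁ hΦ hΦc hΨ hΨc hd hint hτ hminΦ h⟩
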